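/- **Setting.** Let $d\ge 1$ and $k\ge 0$ be integers, and let $\mathbb V$ be a complete separable metric linear space over $\mathbb C$ with translation invariant metric $d_{\mathbb V}$ (addition and scalar multiplication are continuous). Let $\Lambda_k$ be the space of complex measures $\lambda$ on $\mathbb R^d$ with finite support such that $\int p\,d\lambda=0$ for every complex polynomial $p$ of degree at most $k$. For $s\in\mathbb R^d$ and $r>0$ let $r\cdot\lambda=\lambda(r^{-1}\,\cdot)$ and $s+\lambda=\lambda(\cdot-s)$. Fix points $t_1,\dots,t_M\in\mathbb R^d$, where $M=\binom{k+d}{k}$, such that the $M\times M$ matrix $B=(b(t_1),\dots,b(t_M))$ is invertible, where $b(t)$ is the vector of all monomials of degree at most $k$ evaluated at $t$, and let $\lambda_t=\delta_t-(\delta_{t_1},\dots,\delta_{t_M})B^{-1}b(t)\in\Lambda_k$. Let $S_c=S_c(\Lambda_k,\mathbb V)$ be the space of linear maps $f:\Lambda_k\to\mathbb V$ such that $t\mapsto f(\lambda_t)$ is continuous on $\mathbb R^d$, with the topology of uniform convergence of $t\mapsto f(\lambda_t)$ on compact sets and its Borel $\sigma$-field. A *scaling action* on $\mathbb V$ is a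 family of (possibly nonlinear) maps $T_a:\mathbb V\to\mathbb V$, $a>0$, such that $T_a\circ T_b=T_{ab}$; $T_1$ is the identity and $T_a(0)=0$; $T_{a_n}(x_n)\to T_a(x)$ whenever $a_n\to a>0$ and $x_n\to x$; $d_{\mathbb V}(T_a(x),0)<d_{\mathbb V}(T_b(x),0)$ for $x\neq 0$ and $0<a<b$; and $T_a(x)\to 0$ as $a\downarrow 0$ for every $x$. Let $X$ be a random element of $S_c$, let $s\in\mathbb R^d$, and let $T_s=\{T_{s,a},\,a>0\}$ be a scaling action on $\mathbb V$. A random element $Y_s$ of $S_c$ (possibly on another probability space) is a *$k$-th order tangent field to $X$ at $s$ based on $T_s$, with normalizing function* $c(s,\cdot):(0,\infty)\to(0,\infty)$, if $\mathbb P(Y_s=0)<1$ and $$\{T_{s,c(s,r)}(X(s+r\cdot\lambda)),\ \lambda\in\Lambda_k\}\ \xrightarrow{\ d\ }\ \{Y_s(\lambda),\ \lambda\in\Lambda_k\}\quad\text{in } S_c \text{ as } r\downarrow 0,$$ where it is understood that the process on the left is, almost surely, a random element of $S_c$ for every $r>0$ (automatic if the maps $T_{s,a}$ are complex linear). **Theorem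 3.1.** Let $Y_s$ be a $k$-th order tangent field to $X$ at $s$ based on $T_s$, with normalizing function $c(s,\cdot)$. (i) There is a constant $\alpha(s)>0$ such that, for all $r>0$, $$\{Y_s(r\cdot\lambda),\ \lambda\in\Lambda_k\}\ \overset{d}{=}\ \{T_{s,r^{\alpha(s)}}(Y_s(\lambda)),\ \lambda\in\Lambda_k\}$$ as random elements of $S_c$ (in particular, the right-hand side is almost surely in $S_c$). Moreover $c(s,r)=r^{-\alpha(s)}\ell_s(r)$ for all $r>0$, where $\ell_s:(0,\infty)\to(0,\infty)$ is slowly varying at $0$: for every fixed $h>0$, $\ell_s(hr)/\ell_s(r)\to 1$ as $r\downarrow 0$. (ii) If $\widetilde Y_s$ is also a $k$-th order tangent field to $X$ at $s$ based on $T_s$, with normalizing function $\widetilde c(s,\cdot)$, then for some $a\in(0,\infty)$ $$\lim_{r\downarrow 0}\frac{\widetilde c(s,r)}{c(s,r)}=a\qquad\text{and}\qquad \widetilde Y_s\overset{d}{=}T_{s,a}(Y_s)$$ as random elements of $S_c$. -/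

import Mathlib

open MeasureTheory Filter Topology

noncomputable section

namespace TangentField

/-! ### Finitely supported complex measures and the annihilator spaces -/

/-- `ℝ^d` with its Euclidean norm. -/
abbrev Point (d : ℕ) : Type := EuclideanSpace ℝ (Fin d)

/-- Complex measures on `ℝ^d` supported on finitely many points: the finitely supported function
`l` stands for the measure `∑ t, l t • δ_t`. -/
abbrev FinMeasure (d : ℕ) : Type := Point d →₀ ℂ

/-- `∫ g dl = ∑ t, l t • g t`, for a function `g` with values in a complex vector space. -/
def integral {d : ℕ} {V : Type*} [AddCommGroup V] [Module ℂ V]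
    (g : Point d → V) (l : FinMeasure d) : V :=
  l.sum fun t c => c • g t

/-- The function on `ℝ^d` given by a complex polynomial in `d` variables. -/
def polyFun {d : ℕ} (p : MvPolynomial (Fin d) ℂ) (t : Point d) : ℂ :=
  MvPolynomial.eval (fun i => ((t i : ℝ) : ℂ)) p

/-- `Λ_k`: the finitely supported measures that annihilate all polynomials of degree at
most `k`. -/
def Annihilator (d k : ℕ) : Submodule ℂ (FinMeasure d) where
  carrier := {l | ∀ p : MvPolynomial (Fin d) ℂ, p.totalDegree ≤ k → integral (polyFun p) l = 0}
  zero_mem' := by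
    intro p _
    simp [integral]
  add_mem' := by
    intro a b ha hb p hp
    have h : integral (polyFun p) (a + b) = integral (polyFun p) a + integral (polyFun p) b := by
      unfold integral
      exact Finsupp.sum_add_index' (by simp) (by intros; simp [add_mul])
    rw [h, ha p hp, hb p hp, add_zero]
  smul_mem' := by
    intro c a ha p hp
    have h : integral (polyFun p) (c • a) = c • integral (polyFun p) a := by
      unfold integral
      rw [Finsupp.sum_smul_index (by simp), Finsupp.smul_sum]
      simp [mul_assoc]
    rw [h, ha p hp, smul_zero]

/-- `s + r · l`: the image of the measure `l` under `t ↦ s + r t`. -/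
def affineMap {d : ℕ} (s : Point d) (r : ℝ) (l : FinMeasure d) : FinMeasure d :=
  l.mapDomain fun t => s + r • t

theorem integral_affineMap {d : ℕ} (s : Point d) (r : ℝ) (l : FinMeasure d) (g : Point d → ℂ) :
    integral g (affineMap s r l) = integral (fun t => g (s + r • t)) l := by
  unfold integral affineMap
  exact Finsupp.sum_mapDomain_index (by simp) (by intros; simp [add_mul])

/-- The polynomial `u ↦ p (s + r u)`. -/
def affinePoly {d : ℕ} (s : Point d) (r : ℝ) (p : MvPolynomial (Fin d) ℂ) :
    MvPolynomial (Fin d) ℂ :=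
  MvPolynomial.bind₁ (fun i => MvPolynomial.C ((s i : ℝ) : ℂ) +
    MvPolynomial.C (r : ℂ) * MvPolynomial.X i) p

theorem polyFun_affinePoly {d : ℕ} (s : Point d) (r : ℝ) (p : MvPolynomial (Fin d) ℂ)
    (t : Point d) : polyFun (affinePoly s r p) t = polyFun p (s + r • t) := by
  unfold polyFun affinePoly
  rw [← MvPolynomial.coe_aeval_eq_eval, ← MvPolynomial.coe_aeval_eq_eval]
  simp only [RingHom.coe_coe]
  rw [MvPolynomial.aeval_bind₁]
  congr 2
  ext i
  simp

theorem totalDegree_affinePoly_le {d : ℕ} (s : Point d) (r : ℝ) (p : MvPolynomial (Fin d) ℂ) :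
    (affinePoly s r p).totalDegree ≤ p.totalDegree := by
  unfold affinePoly
  rw [MvPolynomial.bind₁, MvPolynomial.aeval_def, MvPolynomial.eval₂_eq]
  refine MvPolynomial.totalDegree_finsetSum_le fun m hm => ?_
  refine (MvPolynomial.totalDegree_mul _ _).trans ?_
  have h1 : ((algebraMap ℂ (MvPolynomial (Fin d) ℂ)) (MvPolynomial.coeff m p)).totalDegree = 0 :=
    MvPolynomial.totalDegree_C _
  rw [h1, zero_add]
  refine (MvPolynomial.totalDegree_finsetProd _ _).trans ?_
  refine le_trans ?_ (MvPolynomial.le_totalDegree hm)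
  rw [Finsupp.sum]
  refine Finset.sum_le_sum fun i _ => ?_
  refine (MvPolynomial.totalDegree_pow _ _).trans ?_
  have h2 : (MvPolynomial.C ((s i : ℝ) : ℂ) +
      MvPolynomial.C (r : ℂ) * MvPolynomial.X i : MvPolynomial (Fin d) ℂ).totalDegree ≤ 1 := by
    refine (MvPolynomial.totalDegree_add _ _).trans (max_le (by simp) ?_)
    refine (MvPolynomial.totalDegree_mul _ _).trans ?_
    simp
  calc m i * _ ≤ m i * 1 := Nat.mul_le_mul_left _ h2
    _ = m i := mul_one _

theorem affineMap_mem {d k : ℕ} (s : Point d) (r : ℝ) {l : FinMeasure d}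
    (hl : l ∈ Annihilator d k) : affineMap s r l ∈ Annihilator d k := by
  intro p hp
  rw [integral_affineMap]
  have h := hl (affinePoly s r p) ((totalDegree_affinePoly_le s r p).trans hp)
  rw [← h]
  congr 1
  ext t
  rw [polyFun_affinePoly]

/-- The operation `l ↦ s + r · l` on `Λ_k`. -/
def rescale {d k : ℕ} (s : Point d) (r : ℝ) (l : Annihilator d k) : Annihilator d k :=
  ⟨affineMap s r l, affineMap_mem s r l.2⟩

/-! ### Nodes, representations, and the path space -/

/-- The exponents of the monomials of degree at most `k` in `d` variables. -/
abbrev MonomialIndex (d k : ℕ) : Type := {m : Fin d → Fin (k + 1) // ∑ i, (m i : ℕ) ≤ k}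

/-- The vector `b(t)` of all monomials of degree at most `k` at `t`. -/
def monomials {d : ℕ} (k : ℕ) (t : Point d) (m : MonomialIndex d k) : ℝ :=
  ∏ i, t i ^ (m.1 i : ℕ)

/-- The matrix `B` with columns `b(t_j)`. -/
def nodeMatrix {d k : ℕ} (pts : MonomialIndex d k → Point d) :
    Matrix (MonomialIndex d k) (MonomialIndex d k) ℝ :=
  Matrix.of fun m j => monomials k (pts j) m

/-- Points `t_1, …, t_M`, as many as there are monomials of degree at most `k`, for which the
matrix `B` has full rank. -/
structure Nodes (d k : ℕ) where
  pts : MonomialIndex d k → Point d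
  det_ne_zero : (nodeMatrix pts).det ≠ 0

/-- The measure `λ_t = δ_t - (δ_{t_1}, …, δ_{t_M}) B⁻¹ b(t)`. -/
def Nodes.measure {d k : ℕ} (τ : Nodes d k) (t : Point d) : FinMeasure d :=
  Finsupp.single t 1 - ∑ j : MonomialIndex d k,
    Finsupp.single (τ.pts j) ((((nodeMatrix τ.pts)⁻¹.mulVec (monomials k t)) j : ℝ) : ℂ)

theorem Nodes.reproduces {d k : ℕ} (τ : Nodes d k) (t : Point d) (m : MonomialIndex d k) :
    ∑ j, ((nodeMatrix τ.pts)⁻¹.mulVec (monomials k t)) j * monomials k (τ.pts j) m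
      = monomials k t m := by
  have h : (nodeMatrix τ.pts).mulVec ((nodeMatrix τ.pts)⁻¹.mulVec (monomials k t))
      = monomials k t := by
    rw [Matrix.mulVec_mulVec, Matrix.mul_nonsing_inv _ (isUnit_iff_ne_zero.mpr τ.det_ne_zero),
      Matrix.one_mulVec]
  have h' := congrFun h m
  rw [← h']
  conv_rhs => rw [Matrix.mulVec, dotProduct]
  refine Finset.sum_congr rfl fun j _ => ?_
  simp [nodeMatrix, mul_comm]

theorem integral_single {d : ℕ} (g : Point d → ℂ) (t : Point d) (c : ℂ) :
    integral g (Finsupp.single t c) = c * g t := by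
  simp [integral]

theorem Nodes.measure_mem {d k : ℕ} (τ : Nodes d k) (t : Point d) :
    τ.measure t ∈ Annihilator d k := by
  intro p hp
  have hlin : ∀ g : Point d → ℂ, integral g (τ.measure t) = g t -
      ∑ j, ((((nodeMatrix τ.pts)⁻¹.mulVec (monomials k t)) j : ℝ) : ℂ) * g (τ.pts j) := by
    intro g
    have hL : ∀ l : FinMeasure d, integral g l = Finsupp.linearCombination ℂ g l := by
      intro l
      rw [Finsupp.linearCombination_apply, integral]
    rw [hL, Nodes.measure, map_sub, map_sum]
    simp [Finsupp.linearCombination_single]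
  rw [hlin, sub_eq_zero]
  have hexp : ∀ u : Point d, polyFun p u =
      ∑ m ∈ p.support, p.coeff m * ∏ i, ((u i : ℝ) : ℂ) ^ (m i) := by
    intro u
    unfold polyFun
    rw [MvPolynomial.eval_eq']
  simp only [hexp, Finset.mul_sum]
  rw [Finset.sum_comm]
  refine Finset.sum_congr rfl fun m hm => ?_
  have hdeg : ∑ i, m i ≤ k := by
    have h := (MvPolynomial.le_totalDegree hm).trans hp
    rwa [Finsupp.sum_fintype _ _ (by simp)] at h
  have hlt : ∀ i, m i < k + 1 := fun i =>
    Nat.lt_succ_of_le ((Finset.single_le_sum (f := fun i => m i) (fun _ _ => Nat.zero_le _)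
      (Finset.mem_univ i)).trans hdeg)
  let M : MonomialIndex d k := ⟨fun i => ⟨m i, hlt i⟩, hdeg⟩
  have hM : ∀ u : Point d, ∏ i, ((u i : ℝ) : ℂ) ^ (m i) = ((monomials k u M : ℝ) : ℂ) := by
    intro u
    simp [monomials, M]
  simp only [hM]
  rw [← τ.reproduces t M]
  push_cast
  rw [Finset.mul_sum]
  refine Finset.sum_congr rfl fun j _ => ?_
  ring

/-- `λ_t` as an element of `Λ_k`. -/
def Nodes.elem {d k : ℕ} (τ : Nodes d k) (t : Point d) : Annihilator d k :=
  ⟨τ.measure t, τ.measure_mem t⟩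

/-- `S_c(Λ_k, V)`: the linear maps `f : Λ_k → V` whose representation `t ↦ f (λ_t)` is
continuous on `ℝ^d`. -/
def PathSpace {d k : ℕ} (τ : Nodes d k) (V : Type*) [AddCommGroup V] [Module ℂ V]
    [TopologicalSpace V] : Type _ :=
  {f : Annihilator d k →ₗ[ℂ] V // Continuous fun t : Point d => f (τ.elem t)}

section PathSpace

variable {d k : ℕ} {τ : Nodes d k} {V : Type*} [AddCommGroup V] [Module ℂ V] [TopologicalSpace V]

instance : CoeFun (PathSpace τ V) (fun _ => Annihilator d k → V) := ⟨fun f => f.1⟩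

/-- The representation `t ↦ f (λ_t)` of `f`, as a continuous function on `ℝ^d`. -/
def PathSpace.repr (f : PathSpace τ V) : C(Point d, V) := ⟨fun t => f (τ.elem t), f.2⟩

/-- The topology of `S_c(Λ_k, V)`: uniform convergence of the representations on the compact
subsets of `ℝ^d` (Mathlib's topology on `C(ℝ^d, V)` is the compact-open one). It is the topology
of the metric
`ρ(f, g) = ∑_{n ≥ 1} 2^{-n} (1 - exp (- sup_{‖t‖ ≤ n} dist (f (λ_t)) (g (λ_t))))`. -/
instance : TopologicalSpace (PathSpace τ V) :=
  TopologicalSpace.induced PathSpace.repr inferInstance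

/-- The Borel `σ`-field of `S_c(Λ_k, V)`. -/
instance : MeasurableSpace (PathSpace τ V) := borel _

instance : BorelSpace (PathSpace τ V) := ⟨rfl⟩

end PathSpace

/-! ### Scaling actions -/

/-- A scaling action on `V`: a family of maps `T a : V → V`, `a > 0`, not assumed to be linear
(the values of `T` at `a ≤ 0` are irrelevant). -/
structure IsScalingAction {V : Type*} [Zero V] [PseudoMetricSpace V] (T : ℝ → V → V) : Prop where
  comp : ∀ a b : ℝ, 0 < a → 0 < b → ∀ x, T a (T b x) = T (a * b) x
  one : ∀ x, T 1 x = x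
  zero : ∀ a : ℝ, 0 < a → T a 0 = 0
  continuous : ∀ (a : ℕ → ℝ) (a₀ : ℝ) (x : ℕ → V) (x₀ : V), (∀ n, 0 < a n) → 0 < a₀ →
    Tendsto a atTop (𝓝 a₀) → Tendsto x atTop (𝓝 x₀) →
    Tendsto (fun n => T (a n) (x n)) atTop (𝓝 (T a₀ x₀))
  radial : ∀ x : V, x ≠ 0 → ∀ a b : ℝ, 0 < a → a < b → dist (T a x) 0 < dist (T b x) 0
  tendsto_zero : ∀ x : V, Tendsto (fun a => dist (T a x) 0) (𝓝[>] 0) (𝓝 0)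

/-! ### Random elements of the path space, equality and convergence in distribution -/

section Law

variable {d k : ℕ} {τ : Nodes d k} {V : Type*} [AddCommGroup V] [Module ℂ V] [TopologicalSpace V]

/-- The `V`-valued process `ξ = {ξ(l), l ∈ Λ_k}` is, almost surely, the random element `Z` of
`S_c(Λ_k, V)`. (A process such as `{T_a (X(l))}` with a nonlinear `T_a` need not have linear paths,
so that being a random element of `S_c(Λ_k, V)` has to be said.) -/
structure IsRandomElement {Ω : Type*} [MeasurableSpace Ω] (P : Measure Ω)
    (Z : Ω → PathSpace τ V) (ξ : Ω → Annihilator d k → V) : Prop where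
  measurable : Measurable Z
  ae_eq : ∀ᵐ ω ∂P, ∀ l : Annihilator d k, Z ω l = ξ ω l

/-- Equality in distribution of two processes, as random elements of `S_c(Λ_k, V)`; in
particular, both are random elements of that space. -/
def EqInDistribution (τ : Nodes d k) {Ω Ω' : Type*} [MeasurableSpace Ω] [MeasurableSpace Ω']
    (P : Measure Ω) (P' : Measure Ω')
    (ξ : Ω → Annihilator d k → V) (η : Ω' → Annihilator d k → V) : Prop :=
  ∃ (Z : Ω → PathSpace τ V) (W : Ω' → PathSpace τ V),
    IsRandomElement P Z ξ ∧ IsRandomElement P' W η ∧ P.map Z = P'.map W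

/-- `ξ_r → Y` in distribution in `S_c(Λ_k, V)` as `r ↓ 0`; in particular, every `ξ_r`, `r > 0`, is
a random element of that space. -/
def ConvergesInDistribution {Ω Ω' : Type*} [MeasurableSpace Ω] [MeasurableSpace Ω']
    (P : Measure Ω) (P' : Measure Ω') [IsProbabilityMeasure P] [IsProbabilityMeasure P']
    (ξ : ℝ → Ω → Annihilator d k → V) (Y : Ω' → PathSpace τ V) : Prop :=
  ∃ Z : ℝ → Ω → PathSpace τ V, (∀ r : ℝ, 0 < r → IsRandomElement P (Z r) (ξ r)) ∧
    TendstoInDistribution Z (𝓝[>] 0) Y (fun _ => P) P'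

end Law

/-! ### Tangent fields and slowly varying functions -/

/-- `Y`, a random element of `S_c(Λ_k, V)` on `(Ω', P')`, is a `k`-th order tangent field at `s` to
the random element `X` of `S_c(Λ_k, V)` on `(Ω, P)`, based on the scaling action `T` and with the
normalizing function `c`: `Y` is non-zero, i.e. `P'(Y = 0) < 1`, and
`{T_{c(r)} (X(s + r · l)), l ∈ Λ_k} → Y` in distribution as `r ↓ 0`. -/
structure IsTangentField {d k : ℕ} {τ : Nodes d k} {V : Type*} [AddCommGroup V] [Module ℂ V]
    [TopologicalSpace V] {Ω Ω' : Type*} [MeasurableSpace Ω] [MeasurableSpace Ω']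
    (P : Measure Ω) (P' : Measure Ω') [IsProbabilityMeasure P] [IsProbabilityMeasure P']
    (T : ℝ → V → V) (X : Ω → PathSpace τ V) (s : Point d) (c : ℝ → ℝ)
    (Y : Ω' → PathSpace τ V) : Prop where
  measurable : Measurable Y
  nonzero : ¬ ∀ᵐ ω ∂P', ∀ l : Annihilator d k, Y ω l = 0
  pos : ∀ r : ℝ, 0 < r → 0 < c r
  converges : ConvergesInDistribution P P' (fun r ω l => T (c r) (X ω (rescale s r l))) Y

/-- `ℓ : (0, ∞) → (0, ∞)` is slowly varying at `0`. -/
def SlowlyVaryingAtZero (ℓ : ℝ → ℝ) : Prop :=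
  (∀ r : ℝ, 0 < r → 0 < ℓ r) ∧
    ∀ h : ℝ, 0 < h → Tendsto (fun r => ℓ (h * r) / ℓ r) (𝓝[>] 0) (𝓝 1)

end TangentField

end

/-!
The theorem is a convergence of types theorem for scaling actions. For `h > 0` put
`W r = T (c (h r)) ∘ X (s + h r · l)`. Then `W r → Y` in distribution, and the process
`T (c r / c (h r)) ∘ W r`, which is `T (c r) ∘ X (s + r · (h · l))`, converges to `Y (h · l)`. Both
limits are nonzero, so the scales `c r / c (h r)` have all their limit points in `(0, ∞)`
(`exists_tendsto_scale`): by radial monotonicity, scales tending to `0` would kill the limit, and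
scales tending to `∞` are excluded by exchanging the two processes. The limit `A h` is unique, since
a proper contraction that preserves the law of `Y` can be iterated (`scale_unique`). Hence
`Y (h · l)` has the law of `T (A h) ∘ Y`. The function `A` is multiplicative, and it is continuous
at `1` by another application of the convergence of types, as `Y (h · l)` is continuous in `h`; so
`A h = h ^ α` (`exists_eq_rpow`), with no measurability of `c` needed. The measures in `Λ_k`
annihilate constants, so that `Y (h · l) → 0` as `h ↓ 0`, whence `α > 0` (`exponent_pos`). The
second part is the convergence of types applied to the two normalizations of the same process.

The maps `T a` are not linear, and `T a ∘ f` need not be a linear map on `Λ_k` when `f` is. The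
continuous mapping theorem is therefore needed in an extended form (`eqInDistribution_of_tendsto`),
which yields at the same time that `T a ∘ Y` is almost surely an element of `S_c`. It rests on a
portmanteau inequality for varying sets (`limsup_measure_le_of_frequently`) and on the closedness
of the relation `g = T a ∘ f` on `S_c`, jointly in `a` (`PathSpace.exists_eq_of_frequently`).
-/

noncomputable section

namespace TangentField

/-! ### The path space -/

section Basic

variable {d k : ℕ}

theorem integral_monomials_eq_zero (l : Annihilator d k) (m : MonomialIndex d k) :
    (l.1.sum fun t c => c * ((monomials k t m : ℝ) : ℂ)) = 0 := by
  let q : Fin d →₀ ℕ := Finsupp.equivFunOnFinite.symm fun i => (m.1 i : ℕ)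
  have hq : (MvPolynomial.monomial q (1 : ℂ)).totalDegree ≤ k := by
    rw [MvPolynomial.totalDegree_monomial _ one_ne_zero, Finsupp.sum_fintype _ _ (by simp)]
    exact m.2
  have h := l.2 _ hq
  have hfun : ∀ t : Point d,
      polyFun (MvPolynomial.monomial q (1 : ℂ)) t = ((monomials k t m : ℝ) : ℂ) := by
    intro t
    rw [polyFun, MvPolynomial.eval_monomial, Finsupp.prod_fintype _ _ (by simp)]
    simp [q, monomials]
  simpa [integral, hfun] using h

/-- The interpolation weights `B⁻¹ b(t)` are polynomials of degree at most `k` in `t`, so they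
integrate to zero against `Λ_k`. -/
theorem integral_weights_eq_zero (τ : Nodes d k) (l : Annihilator d k) (j : MonomialIndex d k) :
    (l.1.sum fun t c =>
      c * ((((nodeMatrix τ.pts)⁻¹.mulVec (monomials k t)) j : ℝ) : ℂ)) = 0 := by
  have h : ∀ t : Point d, ((((nodeMatrix τ.pts)⁻¹.mulVec (monomials k t)) j : ℝ) : ℂ)
      = ∑ m, (((nodeMatrix τ.pts)⁻¹ j m : ℝ) : ℂ) * ((monomials k t m : ℝ) : ℂ) := by
    intro t
    rw [Matrix.mulVec, dotProduct]
    push_cast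
    rfl
  simp only [h, Finsupp.sum, Finset.mul_sum]
  rw [Finset.sum_comm]
  refine Finset.sum_eq_zero fun m _ => ?_
  have h0 := integral_monomials_eq_zero l m
  rw [Finsupp.sum] at h0
  calc _ = (((nodeMatrix τ.pts)⁻¹ j m : ℝ) : ℂ) *
        ∑ t ∈ l.1.support, l.1 t * ((monomials k t m : ℝ) : ℂ) := by
        rw [Finset.mul_sum]
        exact Finset.sum_congr rfl fun t _ => by ring
    _ = 0 := by rw [h0, mul_zero]

/-- Every `l ∈ Λ_k` is the combination `∑ l(t) λ_t`. -/
theorem Nodes.sum_smul_elem (τ : Nodes d k) (l : Annihilator d k) :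
    l = ∑ t ∈ l.1.support, l.1 t • τ.elem t := by
  apply Subtype.ext
  rw [AddSubmonoidClass.coe_finsetSum]
  have h : ∀ t, ((l.1 t • τ.elem t : Annihilator d k) : FinMeasure d) = Finsupp.single t (l.1 t)
      - ∑ j : MonomialIndex d k, Finsupp.single (τ.pts j)
        (l.1 t * ((((nodeMatrix τ.pts)⁻¹.mulVec (monomials k t)) j : ℝ) : ℂ)) := by
    intro t
    change l.1 t • τ.measure t = _
    rw [Nodes.measure, smul_sub, Finset.smul_sum]
    simp [Finsupp.smul_single]
  simp only [h, Finset.sum_sub_distrib]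
  rw [Finset.sum_comm]
  have h0 : ∀ j : MonomialIndex d k, (∑ t ∈ l.1.support, Finsupp.single (τ.pts j)
      (l.1 t * ((((nodeMatrix τ.pts)⁻¹.mulVec (monomials k t)) j : ℝ) : ℂ))) = 0 := by
    intro j
    rw [← Finsupp.single_finsetSum]
    have := integral_weights_eq_zero τ l j
    rw [Finsupp.sum] at this
    rw [this, Finsupp.single_zero]
  simp only [h0, Finset.sum_const_zero, sub_zero]
  exact (Finsupp.sum_single l.1).symm

end Basic

section PathSpace

variable {d k : ℕ} {τ : Nodes d k} {V : Type*} [NormedAddCommGroup V] [Module ℂ V]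

theorem PathSpace.eq_of_forall {f g : PathSpace τ V} (h : ∀ l, f l = g l) : f = g :=
  Subtype.ext (LinearMap.ext h)

theorem PathSpace.apply_eq_sum (f : PathSpace τ V) (l : Annihilator d k) :
    f l = ∑ t ∈ l.1.support, l.1 t • f (τ.elem t) := by
  conv_lhs => rw [τ.sum_smul_elem l]
  simp [map_sum]

/-- The zero element of `S_c(Λ_k, V)`. -/
instance : Zero (PathSpace τ V) := ⟨⟨0, continuous_const⟩⟩

@[simp] theorem PathSpace.zero_apply (l : Annihilator d k) : (0 : PathSpace τ V) l = 0 := rfl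

instance : TopologicalSpace.PseudoMetrizableSpace (PathSpace τ V) :=
  (Topology.IsInducing.mk rfl : IsInducing (PathSpace.repr (τ := τ) (V := V))).pseudoMetrizableSpace

theorem PathSpace.continuous_repr : Continuous (PathSpace.repr (τ := τ) (V := V)) :=
  continuous_induced_dom

theorem PathSpace.continuous_apply_elem :
    Continuous fun p : PathSpace τ V × Point d => p.1 (τ.elem p.2) :=
  (continuous_eval (F := C(Point d, V))).comp
    (PathSpace.continuous_repr.prodMap continuous_id)

theorem PathSpace.continuous_apply [ContinuousSMul ℂ V] (l : Annihilator d k) :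
    Continuous fun f : PathSpace τ V => f l := by
  refine (continuous_congr fun f => f.apply_eq_sum l).2 ?_
  refine continuous_finsetSum _ fun t _ => Continuous.const_smul ?_ _
  exact PathSpace.continuous_apply_elem.comp (continuous_id.prodMk continuous_const)

/-- Convergence in `S_c(Λ_k, V)` is continuous convergence of the representations, because `ℝ^d`
is locally compact. -/
theorem PathSpace.tendsto_of_forall {ι : Type*} {u : Filter ι} {F : ι → PathSpace τ V}
    {f : PathSpace τ V}
    (h : ∀ t, Tendsto (fun p : ι × Point d => F p.1 (τ.elem p.2)) (u ×ˢ 𝓝 t)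
      (𝓝 (f (τ.elem t)))) : Tendsto F u (𝓝 f) := by
  rw [nhds_induced, tendsto_comap_iff, ContinuousMap.tendsto_iff_tendstoLocallyUniformly,
    tendstoLocallyUniformly_iff_forall_tendsto]
  intro t
  have h1 : Tendsto (fun p : ι × Point d => f (τ.elem p.2)) (u ×ˢ 𝓝 t) (𝓝 (f (τ.elem t))) :=
    (f.2.tendsto t).comp tendsto_snd
  exact (h1.prodMk_nhds (h t)).mono_right (nhds_le_uniformity _)

instance [ContinuousSMul ℂ V] : T1Space (PathSpace τ V) := by
  refine ⟨fun f => ?_⟩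
  have : ({f} : Set (PathSpace τ V)) = ⋂ l : Annihilator d k, {g | g l = f l} := by
    ext g
    simp only [Set.mem_singleton_iff, Set.mem_iInter, Set.mem_ofPred_eq]
    exact ⟨fun h l => by rw [h], PathSpace.eq_of_forall⟩
  rw [this]
  exact isClosed_iInter fun l => isClosed_eq (PathSpace.continuous_apply l) continuous_const

end PathSpace

/-! ### The rescaling of paths -/

section Rescale

variable {d k : ℕ}

theorem rescale_rescale_zero (s : Point d) (r h : ℝ) (l : Annihilator d k) :
    rescale s r (rescale 0 h l) = rescale s (h * r) l := by
  apply Subtype.ext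
  change Finsupp.mapDomain _ (Finsupp.mapDomain _ l.1) = Finsupp.mapDomain _ l.1
  rw [← Finsupp.mapDomain_comp]
  congr 1
  ext1 t
  simp [smul_smul, mul_comm]

/-- `l ↦ r · l` as a linear map on `Λ_k`. -/
def rescaleLinear (r : ℝ) : Annihilator d k →ₗ[ℂ] Annihilator d k where
  toFun := rescale 0 r
  map_add' _ _ := Subtype.ext (Finsupp.mapDomain_add)
  map_smul' c a := Subtype.ext (Finsupp.mapDomain_smul c a.1)

theorem rescale_zero_one (l : Annihilator d k) : rescale 0 1 l = l := by
  apply Subtype.ext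
  change Finsupp.mapDomain _ l.1 = l.1
  simp only [zero_add, one_smul]
  exact Finsupp.mapDomain_id

theorem rescale_zero_zero (l : Annihilator d k) : rescale 0 0 l = 0 := by
  apply Subtype.ext
  change Finsupp.mapDomain _ l.1 = 0
  have h := l.2 1 (by simp)
  simp only [integral, polyFun, map_one, smul_eq_mul, mul_one] at h
  rw [Finsupp.mapDomain]
  simp only [zero_smul, add_zero]
  rw [Finsupp.sum, ← Finsupp.single_finsetSum]
  rw [Finsupp.sum] at h
  rw [h, Finsupp.single_zero]

variable {τ : Nodes d k} {V : Type*} [NormedAddCommGroup V] [Module ℂ V]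

/-- The measure `r · λ_t` is `δ_{rt}` minus a combination of the point masses `δ_{r t_j}`; its
expansion in the `λ`'s yields the representation of `l ↦ f (r · l)`. -/
theorem PathSpace.apply_rescale_elem (f : PathSpace τ V) (r : ℝ) (t : Point d) :
    f (rescale 0 r (τ.elem t)) = f (τ.elem (r • t)) - ∑ j : MonomialIndex d k,
      ((((nodeMatrix τ.pts)⁻¹.mulVec (monomials k t)) j : ℝ) : ℂ) • f (τ.elem (r • τ.pts j)) := by
  -- Any measure can be integrated against `t ↦ f (λ_t)`, and on `Λ_k` this gives `f` back.
  let L : FinMeasure d →ₗ[ℂ] V := Finsupp.linearCombination ℂ fun t => f (τ.elem t)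
  have hL : ∀ l : Annihilator d k, f l = L l.1 := fun l => by
    rw [PathSpace.apply_eq_sum, Finsupp.linearCombination_apply, Finsupp.sum]
  have h : (rescale 0 r (τ.elem t)).1 = Finsupp.single (r • t) 1 - ∑ j : MonomialIndex d k,
      Finsupp.single (r • τ.pts j)
        ((((nodeMatrix τ.pts)⁻¹.mulVec (monomials k t)) j : ℝ) : ℂ) := by
    change Finsupp.lmapDomain ℂ ℂ (fun t : Point d => 0 + r • t) (τ.measure t) = _
    rw [Nodes.measure, map_sub, map_sum]
    simp [Finsupp.mapDomain_single]
  rw [hL, h, map_sub, map_sum]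
  simp [L, Finsupp.linearCombination_single]

theorem continuous_weights (τ : Nodes d k) (j : MonomialIndex d k) : Continuous fun t : Point d =>
    ((((nodeMatrix τ.pts)⁻¹.mulVec (monomials k t)) j : ℝ) : ℂ) := by
  refine Complex.continuous_ofReal.comp ?_
  simp only [Matrix.mulVec, dotProduct, monomials]
  fun_prop

variable [ContinuousSMul ℂ V]

theorem PathSpace.continuous_apply_rescale_elem :
    Continuous fun p : (ℝ × PathSpace τ V) × Point d =>
      p.1.2 (rescale 0 p.1.1 (τ.elem p.2)) := by
  simp only [PathSpace.apply_rescale_elem]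
  refine Continuous.sub ?_ (continuous_finsetSum _ fun j _ => Continuous.smul ?_ ?_)
  · exact PathSpace.continuous_apply_elem.comp
      ((continuous_snd.comp continuous_fst).prodMk
        ((continuous_fst.comp continuous_fst).smul continuous_snd))
  · exact (continuous_weights τ j).comp continuous_snd
  · exact PathSpace.continuous_apply_elem.comp
      ((continuous_snd.comp continuous_fst).prodMk
        ((continuous_fst.comp continuous_fst).smul continuous_const))

/-- The path `l ↦ f (r · l)`. -/
def PathSpace.dilate (r : ℝ) (f : PathSpace τ V) : PathSpace τ V :=
  ⟨f.1.comp (rescaleLinear r),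
    (PathSpace.continuous_apply_rescale_elem (τ := τ) (V := V)).comp
      ((continuous_const (y := (r, f))).prodMk continuous_id)⟩

theorem PathSpace.dilate_apply (r : ℝ) (f : PathSpace τ V) (l : Annihilator d k) :
    f.dilate r l = f (rescale 0 r l) := rfl

theorem PathSpace.dilate_one (f : PathSpace τ V) : f.dilate 1 = f :=
  PathSpace.eq_of_forall fun l => by rw [PathSpace.dilate_apply, rescale_zero_one]

/-- Contracting a measure that annihilates constants to a point yields the zero measure. -/
theorem PathSpace.dilate_zero (f : PathSpace τ V) : f.dilate 0 = 0 :=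
  PathSpace.eq_of_forall fun l => by
    rw [PathSpace.dilate_apply, rescale_zero_zero]
    exact map_zero f.1

theorem PathSpace.continuous_dilate :
    Continuous fun p : ℝ × PathSpace τ V => p.2.dilate p.1 :=
  continuous_induced_rng.2 <| ContinuousMap.continuous_of_continuous_uncurry _
    PathSpace.continuous_apply_rescale_elem

end Rescale

/-! ### Weak convergence and continuously convergent maps -/

/-- A form of the portmanteau theorem for varying sets: the closed set `C` may be replaced, along
the sequence of measures, by sets `A i` whose upper limit in the sense of Kuratowski is contained
in `C`. -/
theorem limsup_measure_le_of_frequently {ι E : Type*} {u : Filter ι} [u.IsCountablyGenerated]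
    [TopologicalSpace E] [MeasurableSpace E] [BorelSpace E] [HasOuterApproxClosed E]
    {μs : ι → ProbabilityMeasure E} {μ : ProbabilityMeasure E} (hμ : Tendsto μs u (𝓝 μ))
    {A : ι → Set E} {C : Set E} (hC : ∀ x, (∃ᶠ p in u ×ˢ 𝓝 x, p.2 ∈ A p.1) → x ∈ C) :
    limsup (fun i => (μs i : Measure E) (A i)) u ≤ (μ : Measure E) C := by
  obtain ⟨s, hs⟩ := u.exists_antitone_basis
  let B : ℕ → Set E := fun n => closure (⋃ i ∈ s n, A i)
  have hB : Antitone B := fun m n hmn =>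
    closure_mono (Set.biUnion_subset_biUnion_left (hs.antitone hmn))
  have hBC : ⋂ n, B n ⊆ C := by
    intro x hx
    refine hC x ?_
    rw [(hs.1.prod (𝓝 x).basis_sets).frequently_iff]
    rintro ⟨n, U⟩ ⟨-, hU⟩
    obtain ⟨y, hyU, hy⟩ := mem_closure_iff_nhds.1 (Set.mem_iInter.1 hx n) U hU
    obtain ⟨i, hi, hyi⟩ := Set.mem_iUnion₂.1 hy
    exact ⟨(i, y), ⟨hi, hyU⟩, hyi⟩
  have hle : ∀ n, limsup (fun i => (μs i : Measure E) (A i)) u ≤ (μ : Measure E) (B n) := by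
    intro n
    refine le_trans (limsup_le_limsup ?_)
      (ProbabilityMeasure.limsup_measure_closed_le_of_tendsto hμ isClosed_closure)
    filter_upwards [hs.1.mem_of_mem (i := n) trivial] with i hi
    exact measure_mono ((Set.subset_biUnion_of_mem (u := A) hi).trans subset_closure)
  have hlim := tendsto_measure_iInter_atTop (μ := (μ : Measure E))
    (fun n => (isClosed_closure (s := ⋃ i ∈ s n, A i)).measurableSet.nullMeasurableSet) hB
    ⟨0, measure_ne_top _ _⟩
  exact (ge_of_tendsto' hlim hle).trans (measure_mono hBC)

section Transform

variable {d k : ℕ} {τ : Nodes d k} {V : Type*} [NormedAddCommGroup V] [Module ℂ V]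

/-- The path `l ↦ ψ (f l)` when this is an element of `S_c(Λ_k, V)`, and `0` otherwise (the map
`ψ` is not assumed to be linear). -/
def PathSpace.transform (ψ : V → V) (f : PathSpace τ V) : PathSpace τ V :=
  open Classical in
  if h : ∃ g : PathSpace τ V, ∀ l, g l = ψ (f l) then h.choose else 0

theorem PathSpace.transform_apply {ψ : V → V} {f : PathSpace τ V}
    (h : ∃ g : PathSpace τ V, ∀ l, g l = ψ (f l)) (l : Annihilator d k) :
    f.transform ψ l = ψ (f l) := by
  rw [PathSpace.transform, dif_pos h]
  exact h.choose_spec l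

theorem PathSpace.transform_eq_zero {ψ : V → V} {f : PathSpace τ V}
    (h : ¬ ∃ g : PathSpace τ V, ∀ l, g l = ψ (f l)) : f.transform ψ = 0 := by
  rw [PathSpace.transform, dif_neg h]

variable [ContinuousSMul ℂ V] {ι : Type*} {u : Filter ι} {φ : ι → V → V} {ψ : V → V}

/-- If `φ i → ψ` continuously, then the relation `g = φ i ∘ f` on `S_c(Λ_k, V)` is closed, and
`g` converges as soon as `f` does: linearity is inherited by pointwise limits, and continuous
convergence passes to the representations. -/
theorem PathSpace.exists_eq_of_frequently (hψ : Continuous ψ)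
    (hφ : ∀ x, Tendsto (fun p : ι × V => φ p.1 p.2) (u ×ˢ 𝓝 x) (𝓝 (ψ x)))
    {F : Set (PathSpace τ V)} (hF : IsClosed F) {f : PathSpace τ V}
    (h : ∃ᶠ p in u ×ˢ 𝓝 f, ∃ g ∈ F, ∀ l, g l = φ p.1 (p.2 l)) :
    ∃ g ∈ F, ∀ l, g l = ψ (f l) := by
  set S : Set (ι × PathSpace τ V) := {p | ∃ g ∈ F, ∀ l, g l = φ p.1 (p.2 l)} with hS
  have hne : NeBot (u ×ˢ 𝓝 f ⊓ 𝓟 S) := frequently_mem_iff_neBot.1 h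
  have hex : ∀ p : ι × PathSpace τ V, ∃ g : PathSpace τ V,
      p ∈ S → g ∈ F ∧ ∀ l, g l = φ p.1 (p.2 l) := by
    intro p
    by_cases hp : p ∈ S
    · obtain ⟨g, hg⟩ := hp
      exact ⟨g, fun _ => hg⟩
    · exact ⟨0, fun h => absurd h hp⟩
  choose G hG using hex
  have hGS : ∀ᶠ p in u ×ˢ 𝓝 f ⊓ 𝓟 S, G p ∈ F ∧ ∀ l, G p l = φ p.1 (p.2 l) :=
    eventually_inf_principal.2 (Eventually.of_forall hG)
  have hle : u ×ˢ 𝓝 f ⊓ 𝓟 S ≤ u ×ˢ 𝓝 f := inf_le_left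
  have hpt : ∀ l, Tendsto (fun p => G p l) (u ×ˢ 𝓝 f ⊓ 𝓟 S) (𝓝 (ψ (f l))) := by
    intro l
    have h1 : Tendsto (fun p : ι × PathSpace τ V => φ p.1 (p.2 l)) (u ×ˢ 𝓝 f) (𝓝 (ψ (f l))) :=
      (hφ (f l)).comp (tendsto_fst.prodMk
        (((PathSpace.continuous_apply l).tendsto f).comp tendsto_snd))
    exact (h1.mono_left hle).congr' (hGS.mono fun p hp => (hp.2 l).symm)
  let g₀ : PathSpace τ V := ⟨linearMapOfTendsto (fun l => ψ (f l)) (fun p => (G p).1)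
    (tendsto_pi_nhds.2 hpt), hψ.comp f.2⟩
  have hg₀ : ∀ l, g₀ l = ψ (f l) := fun l => rfl
  refine ⟨g₀, ?_, hg₀⟩
  refine hF.mem_of_tendsto (f := G) ?_ (hGS.mono fun p hp => hp.1)
  refine PathSpace.tendsto_of_forall fun t => ?_
  have h1 : Tendsto (fun p : (ι × PathSpace τ V) × Point d => φ p.1.1 (p.1.2 (τ.elem p.2)))
      ((u ×ˢ 𝓝 f) ×ˢ 𝓝 t) (𝓝 (ψ (f (τ.elem t)))) := by
    have h2 : Tendsto (fun p : (ι × PathSpace τ V) × Point d => (p.1.2, p.2))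
        ((u ×ˢ 𝓝 f) ×ˢ 𝓝 t) (𝓝 (f, t)) :=
      (tendsto_snd.comp tendsto_fst).prodMk_nhds tendsto_snd
    exact (hφ (f (τ.elem t))).comp ((tendsto_fst.comp tendsto_fst).prodMk
      (((PathSpace.continuous_apply_elem (τ := τ) (V := V)).tendsto (f, t)).comp h2))
  refine (h1.mono_left (prod_mono_left _ hle)).congr' ?_
  filter_upwards [hGS.prod_inl (𝓝 t)] with p hp using (hp.2 _).symm

theorem PathSpace.isClosed_setOf_eq_comp (hψ : Continuous ψ) {F : Set (PathSpace τ V)}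
    (hF : IsClosed F) : IsClosed {f : PathSpace τ V | ∃ g ∈ F, ∀ l, g l = ψ (f l)} := by
  refine isClosed_iff_frequently.2 fun f hf => ?_
  refine PathSpace.exists_eq_of_frequently (u := pure ()) (φ := fun _ => ψ) hψ
    (fun x => (hψ.tendsto x).comp tendsto_snd) hF ?_
  rw [pure_prod, frequently_map]
  exact hf

theorem PathSpace.measurable_transform (hψ : Continuous ψ) :
    Measurable (PathSpace.transform (τ := τ) ψ) := by
  refine measurable_of_isClosed fun F hF => ?_
  have h1 := (PathSpace.isClosed_setOf_eq_comp (τ := τ) hψ hF).measurableSet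
  have h2 := (PathSpace.isClosed_setOf_eq_comp (τ := τ) hψ isClosed_univ).measurableSet
  have : PathSpace.transform (τ := τ) ψ ⁻¹' F =
      {f : PathSpace τ V | ∃ g ∈ F, ∀ l, g l = ψ (f l)} ∪
      ({f : PathSpace τ V | ∃ g ∈ (Set.univ : Set (PathSpace τ V)), ∀ l, g l = ψ (f l)}ᶜ ∩
        {_f | (0 : PathSpace τ V) ∈ F}) := by
    ext f
    simp only [Set.mem_preimage, Set.mem_union, Set.mem_ofPred_eq, Set.mem_inter_iff,
      Set.mem_compl_iff, Set.mem_univ, true_and]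
    by_cases h : ∃ g : PathSpace τ V, ∀ l, g l = ψ (f l)
    · simp only [h, not_true, false_and, or_false]
      constructor
      · exact fun hf => ⟨_, hf, PathSpace.transform_apply h⟩
      · rintro ⟨g, hg, hgf⟩
        rwa [PathSpace.eq_of_forall fun l => (PathSpace.transform_apply h l).trans (hgf l).symm]
    · have h' : ¬ ∃ g ∈ F, ∀ l, g l = ψ (f l) := fun ⟨g, _, hg⟩ => h ⟨g, hg⟩
      simp only [h, h', PathSpace.transform_eq_zero h, not_false_eq_true, true_and, false_or]
  rw [this]
  exact h1.union (h2.compl.inter (MeasurableSet.const _))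

/-- The extended continuous mapping theorem on `S_c(Λ_k, V)`: if `W i → Y` and
`φ i ∘ W i → Y'` in distribution, and `φ i → ψ` continuously, then `ψ ∘ Y` is almost surely a random
element of `S_c(Λ_k, V)`, with the law of `Y'`. -/
theorem eqInDistribution_of_tendsto [u.IsCountablyGenerated] [u.NeBot] (hψ : Continuous ψ)
    (hφ : ∀ x, Tendsto (fun p : ι × V => φ p.1 p.2) (u ×ˢ 𝓝 x) (𝓝 (ψ x)))
    {Ω Ω₁ Ω₂ : Type*} [MeasurableSpace Ω] [MeasurableSpace Ω₁] [MeasurableSpace Ω₂]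
    {P : Measure Ω} [IsProbabilityMeasure P] {P₁ : Measure Ω₁} [IsProbabilityMeasure P₁]
    {P₂ : Measure Ω₂} [IsProbabilityMeasure P₂]
    {W Z : ι → Ω → PathSpace τ V} {Y : Ω₁ → PathSpace τ V} {Y' : Ω₂ → PathSpace τ V}
    (hY : Measurable Y) (hY' : Measurable Y')
    (hW : TendstoInDistribution W u Y (fun _ => P) P₁)
    (hZ : TendstoInDistribution Z u Y' (fun _ => P) P₂)
    (hWZ : ∀ᶠ i in u, ∀ᵐ ω ∂P, ∀ l, Z i ω l = φ i (W i ω l)) :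
    EqInDistribution τ P₂ P₁ (fun ω l => Y' ω l) (fun ω l => ψ (Y ω l)) := by
  have key : ∀ F : Set (PathSpace τ V), IsClosed F →
      limsup (fun i => P.map (Z i) F) u ≤ P₁ {ω | ∃ g ∈ F, ∀ l, g l = ψ (Y ω l)} := by
    intro F hF
    have h1 := limsup_measure_le_of_frequently hW.tendsto
      (A := fun i => {f | ∃ g ∈ F, ∀ l, g l = φ i (f l)}) (C := {f | ∃ g ∈ F, ∀ l, g l = ψ (f l)})
      (fun f hf => PathSpace.exists_eq_of_frequently hψ hφ hF hf)
    simp only [ProbabilityMeasure.coe_mk] at h1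
    rw [Measure.map_apply hY (PathSpace.isClosed_setOf_eq_comp hψ hF).measurableSet] at h1
    refine le_trans (limsup_le_limsup ?_) h1
    filter_upwards [hWZ] with i hi
    rw [Measure.map_apply_of_aemeasurable (hZ.forall_aemeasurable i) hF.measurableSet]
    refine le_trans (measure_mono_ae ?_)
      (Measure.le_map_apply (hW.forall_aemeasurable i) _)
    filter_upwards [hi] with ω hω hF using ⟨Z i ω, hF, hω⟩
  have hae : ∀ᵐ ω ∂P₁, ∃ g : PathSpace τ V, ∀ l, g l = ψ (Y ω l) := by
    have h1 := key Set.univ isClosed_univ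
    have h2 : ∀ i, P.map (Z i) Set.univ = 1 := fun i =>
      (Measure.isProbabilityMeasure_map (hZ.forall_aemeasurable i)).measure_univ
    simp only [h2, limsup_const, Set.mem_univ, true_and] at h1
    have hm := hY (PathSpace.isClosed_setOf_eq_comp (τ := τ) hψ isClosed_univ).measurableSet
    simp only [Set.mem_univ, true_and] at hm
    exact (prob_compl_eq_zero_iff hm).2 (le_antisymm prob_le_one h1)
  have hm : Measurable fun ω => (Y ω).transform ψ := (PathSpace.measurable_transform hψ).comp hY
  have hlim : TendstoInDistribution Z u (fun ω => (Y ω).transform ψ) (fun _ => P) P₁ := by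
    refine ⟨hZ.forall_aemeasurable, hm.aemeasurable,
      tendsto_of_forall_isClosed_limsup_le' fun F hF => (key F hF).trans ?_⟩
    rw [ProbabilityMeasure.coe_mk, Measure.map_apply hm hF.measurableSet]
    refine measure_mono ?_
    rintro ω ⟨g, hg, hgψ⟩
    change (Y ω).transform ψ ∈ F
    rwa [PathSpace.eq_of_forall fun l =>
      (PathSpace.transform_apply ⟨g, hgψ⟩ l).trans (hgψ l).symm]
  exact ⟨Y', _, ⟨hY', Eventually.of_forall fun ω l => rfl⟩,
    ⟨hm, hae.mono fun ω h => PathSpace.transform_apply h⟩,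
    tendstoInDistribution_unique Z hZ hlim⟩

end Transform

/-! ### Scaling actions -/

section Action

variable {V : Type*} [NormedAddCommGroup V] {T : ℝ → V → V} {ι : Type*} {u : Filter ι} {a : ι → ℝ}

theorem IsScalingAction.dist_le (hT : IsScalingAction T) {b c : ℝ} (hb : 0 < b) (hbc : b ≤ c)
    (x : V) : dist (T b x) 0 ≤ dist (T c x) 0 := by
  rcases hbc.eq_or_lt with rfl | h
  · exact le_rfl
  by_cases hx : x = 0
  · rw [hx, hT.zero b hb, hT.zero c (hb.trans h)]
  · exact (hT.radial x hx b c hb h).le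

theorem IsScalingAction.continuous_apply (hT : IsScalingAction T) {b : ℝ} (hb : 0 < b) :
    Continuous (T b) :=
  continuous_iff_seqContinuous.2 fun x x₀ hx =>
    hT.continuous (fun _ => b) b x x₀ (fun _ => hb) hb tendsto_const_nhds hx

theorem IsScalingAction.inv_apply (hT : IsScalingAction T) {b : ℝ} (hb : 0 < b) {x y : V}
    (h : x = T b y) : y = T b⁻¹ x := by
  rw [h, hT.comp _ _ (inv_pos.2 hb) hb, inv_mul_cancel₀ hb.ne', hT.one]

theorem IsScalingAction.tendsto_of_pos (hT : IsScalingAction T) [u.IsCountablyGenerated]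
    (ha : ∀ᶠ i in u, 0 < a i) {b : ℝ} (hb : 0 < b) (hab : Tendsto a u (𝓝 b)) (x : V) :
    Tendsto (fun p : ι × V => T (a p.1) p.2) (u ×ˢ 𝓝 x) (𝓝 (T b x)) := by
  refine tendsto_of_seq_tendsto fun v hv => ?_
  have h1 : Tendsto (fun n => (v n).1) atTop u := tendsto_fst.comp hv
  have h2 : Tendsto (fun n => (v n).2) atTop (𝓝 x) := tendsto_snd.comp hv
  have hpos : ∀ᶠ n in atTop, 0 < a (v n).1 := h1.eventually ha
  -- The finitely many nonpositive values of the parameter are replaced by `b`.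
  have heq : ∀ᶠ n in atTop, (if 0 < a (v n).1 then a (v n).1 else b) = a (v n).1 :=
    hpos.mono fun n hn => if_pos hn
  refine (hT.continuous (fun n => if 0 < a (v n).1 then a (v n).1 else b) b (fun n => (v n).2) x
    (fun n => ?_) hb (((hab.comp h1)).congr' (heq.mono fun n hn => hn.symm)) h2).congr'
    (heq.mono fun n hn => ?_)
  · split_ifs with h
    exacts [h, hb]
  · simp only [hn, Function.comp]

/-- As the parameter tends to `0`, a scaling action tends to `0` continuously, by the radial
monotonicity. -/
theorem IsScalingAction.tendsto_of_zero (hT : IsScalingAction T)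
    (ha : ∀ᶠ i in u, 0 < a i) (hab : Tendsto a u (𝓝 0)) (x : V) :
    Tendsto (fun p : ι × V => T (a p.1) p.2) (u ×ˢ 𝓝 x) (𝓝 0) := by
  rw [Metric.tendsto_nhds]
  intro ε hε
  have h1 : ∀ᶠ b in 𝓝[>] (0 : ℝ), dist (T b x) 0 < ε := (hT.tendsto_zero x).eventually_lt_const hε
  obtain ⟨b, hb, hb0⟩ := (h1.and self_mem_nhdsWithin).exists
  have h2 : ∀ᶠ y in 𝓝 x, dist (T b y) 0 < ε :=
    (((hT.continuous_apply hb0).tendsto x).dist tendsto_const_nhds).eventually_lt_const hb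
  filter_upwards [(ha.and (hab.eventually_lt_const hb0)).prod_mk h2] with p hp
  exact (hT.dist_le hp.1.1 hp.1.2.le _).trans_lt hp.2

end Action

/-! ### Convergence of types -/

section Types

variable {d k : ℕ} {τ : Nodes d k} {V : Type*} [NormedAddCommGroup V] [Module ℂ V]
  [ContinuousSMul ℂ V]
  {Ω Ω₁ Ω₂ : Type*} [MeasurableSpace Ω] [MeasurableSpace Ω₁] [MeasurableSpace Ω₂]
  {P : Measure Ω} {P₁ : Measure Ω₁} {P₂ : Measure Ω₂}
  {Y : Ω₁ → PathSpace τ V} {Y' : Ω₂ → PathSpace τ V} {T : ℝ → V → V}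

theorem eqInDistribution_iff {ψ : V → V} (hψ : Continuous ψ) (hY : Measurable Y)
    (hY' : Measurable Y') :
    EqInDistribution τ P₂ P₁ (fun ω l => Y' ω l) (fun ω l => ψ (Y ω l)) ↔
      (∀ᵐ ω ∂P₁, ∀ l, (Y ω).transform ψ l = ψ (Y ω l)) ∧
        P₂.map Y' = P₁.map fun ω => (Y ω).transform ψ := by
  constructor
  · rintro ⟨Z, W, hZ, hW, h⟩
    have h1 : ∀ᵐ ω ∂P₁, ∀ l, (Y ω).transform ψ l = ψ (Y ω l) :=
      hW.ae_eq.mono fun ω hω => PathSpace.transform_apply ⟨W ω, hω⟩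
    refine ⟨h1, ?_⟩
    rw [Measure.map_congr (show Y' =ᵐ[P₂] Z from
      hZ.ae_eq.mono fun ω hω => PathSpace.eq_of_forall fun l => (hω l).symm), h]
    refine Measure.map_congr ?_
    filter_upwards [hW.ae_eq, h1] with ω hω h1ω
    exact PathSpace.eq_of_forall fun l => (hω l).trans (h1ω l).symm
  · rintro ⟨h1, h2⟩
    exact ⟨Y', _, ⟨hY', Eventually.of_forall fun ω l => rfl⟩,
      ⟨(PathSpace.measurable_transform hψ).comp hY, h1⟩, h2⟩

theorem ae_eq_zero_of_map_eq (hY : Measurable Y) (hY' : Measurable Y')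
    (h : P₂.map Y' = P₁.map Y) (h0 : ∀ᵐ ω ∂P₁, ∀ l, Y ω l = 0) : ∀ᵐ ω ∂P₂, ∀ l, Y' ω l = 0 := by
  have hm : MeasurableSet {f : PathSpace τ V | f = 0} := isClosed_singleton.measurableSet
  have h1 : ∀ᵐ f ∂(P₁.map Y), f = 0 :=
    (ae_map_iff hY.aemeasurable hm).2 (h0.mono fun ω hω => PathSpace.eq_of_forall hω)
  rw [← h, ae_map_iff hY'.aemeasurable hm] at h1
  exact h1.mono fun ω hω l => by rw [hω, PathSpace.zero_apply]

theorem ae_eq_zero_of_eqInDistribution {η : Ω₁ → Annihilator d k → V}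
    (h : EqInDistribution τ P₂ P₁ (fun ω l => Y' ω l) η) (h0 : ∀ᵐ ω ∂P₁, ∀ l, η ω l = 0) :
    ∀ᵐ ω ∂P₂, ∀ l, Y' ω l = 0 := by
  obtain ⟨Z, W, hZ, hW, h⟩ := h
  have h1 := ae_eq_zero_of_map_eq hW.measurable hZ.measurable h
    ((hW.ae_eq.and h0).mono fun ω hω l => (hω.1 l).trans (hω.2 l))
  exact (hZ.ae_eq.and h1).mono fun ω hω l => (hω.1 l).symm.trans (hω.2 l)

variable [IsProbabilityMeasure P₁]

theorem tendstoInDistribution_comp_tendsto {ι κ E : Type*} [TopologicalSpace E] [MeasurableSpace E]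
    [OpensMeasurableSpace E] [IsProbabilityMeasure P] {u : Filter ι} {v : Filter κ}
    {W : ι → Ω → E} {Y : Ω₁ → E}
    (h : TendstoInDistribution W u Y (fun _ => P) P₁) {n : κ → ι} (hn : Tendsto n v u) :
    TendstoInDistribution (fun i => W (n i)) v Y (fun _ => P) P₁ :=
  ⟨fun _ => h.forall_aemeasurable _, h.aemeasurable_limit, h.tendsto.comp hn⟩

theorem tendstoInDistribution_congr_map {ι E : Type*} [TopologicalSpace E] [MeasurableSpace E]
    [OpensMeasurableSpace E] [IsProbabilityMeasure P] [IsProbabilityMeasure P₂] {u : Filter ι}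
    {W : ι → Ω → E} {W' : ι → Ω₂ → E} {Y : Ω₁ → E}
    (h : TendstoInDistribution W u Y (fun _ => P) P₁) (hW' : ∀ i, AEMeasurable (W' i) P₂)
    (hWW' : ∀ᶠ i in u, P.map (W i) = P₂.map (W' i)) :
    TendstoInDistribution W' u Y (fun _ => P₂) P₁ :=
  ⟨hW', h.aemeasurable_limit, h.tendsto.congr' (hWW'.mono fun _ hi => Subtype.ext hi)⟩

/-- The iterates of a proper contraction by `q` that preserves the law of `Y` are the maps
`T (q ^ n)`, which tend to `0`. -/
theorem ae_eq_zero_of_map_transform_eq (hT : IsScalingAction T) {q : ℝ} (hq : 0 < q) (hq1 : q < 1)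
    (hY : Measurable Y) (hae : ∀ᵐ ω ∂P₁, ∀ l, (Y ω).transform (T q) l = T q (Y ω l))
    (hlaw : P₁.map (fun ω => (Y ω).transform (T q)) = P₁.map Y) :
    ∀ᵐ ω ∂P₁, ∀ l, Y ω l = 0 := by
  have hν : IsProbabilityMeasure (P₁.map Y) := Measure.isProbabilityMeasure_map hY.aemeasurable
  have hA : Measurable (PathSpace.transform (τ := τ) (T q)) :=
    PathSpace.measurable_transform (hT.continuous_apply hq)
  have hmp : MeasurePreserving (PathSpace.transform (τ := τ) (T q)) (P₁.map Y) (P₁.map Y) := by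
    refine ⟨hA, ?_⟩
    rw [Measure.map_map hA hY]
    exact hlaw
  have hdom : ∀ᵐ f ∂(P₁.map Y), ∀ l, PathSpace.transform (T q) f l = T q (f l) := by
    have hm : MeasurableSet {f : PathSpace τ V | ∀ l, f.transform (T q) l = T q (f l)} := by
      have := (PathSpace.isClosed_setOf_eq_comp (τ := τ) (hT.continuous_apply hq)
        isClosed_univ).measurableSet
      convert this using 1
      ext f
      exact ⟨fun h => ⟨_, Set.mem_univ _, h⟩,
        fun ⟨g, _, hg⟩ => PathSpace.transform_apply ⟨g, hg⟩⟩
    exact (ae_map_iff hY.aemeasurable hm).2 hae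
  have hiter : ∀ᵐ f ∂(P₁.map Y), ∀ n l,
      ((PathSpace.transform (T q))^[n] f) l = T (q ^ n) (f l) := by
    have hall : ∀ᵐ f ∂(P₁.map Y), ∀ n l,
        PathSpace.transform (T q) ((PathSpace.transform (T q))^[n] f) l
          = T q (((PathSpace.transform (T q))^[n] f) l) :=
      ae_all_iff.2 fun n => (hmp.iterate n).quasiMeasurePreserving.ae hdom
    filter_upwards [hall] with f hf n l
    induction n with
    | zero => simp [hT.one]
    | succ n ih =>
      rw [Function.iterate_succ_apply', hf n l, ih, hT.comp _ _ hq (pow_pos hq n), pow_succ']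
  have hlim : TendstoInDistribution (fun n => (PathSpace.transform (τ := τ) (T q))^[n]) atTop id
      (fun _ => P₁.map Y) (P₁.map Y) :=
    tendstoInDistribution_congr_map (tendstoInDistribution_const aemeasurable_id)
      (fun n => (hmp.iterate n).measurable.aemeasurable)
      (Eventually.of_forall fun n => by rw [(hmp.iterate n).map_eq, Measure.map_id])
  have h := eqInDistribution_of_tendsto (ψ := fun _ => (0 : V)) continuous_const
    (hT.tendsto_of_zero (Eventually.of_forall fun n => pow_pos hq n)
      (tendsto_pow_atTop_nhds_zero_of_lt_one hq.le hq1))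
    measurable_id measurable_id (tendstoInDistribution_const aemeasurable_id) hlim
    (Eventually.of_forall fun n => hiter.mono fun f hf l => hf n l)
  have h0 := ae_eq_zero_of_eqInDistribution h (Eventually.of_forall fun _ _ => rfl)
  exact ae_of_ae_map hY.aemeasurable h0

/-- The scale of a nonzero random element is determined by its law. -/
theorem scale_unique (hT : IsScalingAction T) (hY : Measurable Y) (hY' : Measurable Y')
    (hY'0 : ¬ ∀ᵐ ω ∂P₂, ∀ l, Y' ω l = 0) {a b : ℝ} (ha : 0 < a) (hb : 0 < b)
    (h1 : EqInDistribution τ P₂ P₁ (fun ω l => Y' ω l) (fun ω l => T a (Y ω l)))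
    (h2 : EqInDistribution τ P₂ P₁ (fun ω l => Y' ω l) (fun ω l => T b (Y ω l))) : a = b := by
  wlog hab : a < b generalizing a b
  · by_contra hne
    exact hne (this hb ha h2 h1 ((Ne.symm hne).lt_of_le (not_lt.1 hab))).symm
  exfalso
  obtain ⟨ha1, ha2⟩ := (eqInDistribution_iff (hT.continuous_apply ha) hY hY').1 h1
  obtain ⟨hb1, hb2⟩ := (eqInDistribution_iff (hT.continuous_apply hb) hY hY').1 h2
  have hW : Measurable fun ω => (Y ω).transform (T b) :=
    (PathSpace.measurable_transform (hT.continuous_apply hb)).comp hY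
  have hq : 0 < a / b := div_pos ha hb
  have hrel : ∀ᵐ ω ∂P₁, ∀ l,
      (Y ω).transform (T a) l = T (a / b) ((Y ω).transform (T b) l) := by
    filter_upwards [ha1, hb1] with ω hωa hωb l
    rw [hωa, hωb, hT.comp _ _ hq hb, div_mul_cancel₀ _ hb.ne']
  have hae : ∀ᵐ ω ∂P₁, ∀ l, ((Y ω).transform (T b)).transform (T (a / b)) l
      = T (a / b) ((Y ω).transform (T b) l) :=
    hrel.mono fun ω hω => PathSpace.transform_apply ⟨_, hω⟩
  have hlaw : P₁.map (fun ω => ((Y ω).transform (T b)).transform (T (a / b)))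
      = P₁.map fun ω => (Y ω).transform (T b) := by
    rw [← hb2, ha2]
    refine Measure.map_congr ?_
    filter_upwards [hrel, hae] with ω h h'
    exact PathSpace.eq_of_forall fun l => (h' l).trans (h l).symm
  exact hY'0 (ae_eq_zero_of_map_eq hW hY' hb2
    (ae_eq_zero_of_map_transform_eq hT hq ((div_lt_one hb).2 hab) hW hae hlaw))

variable [IsProbabilityMeasure P] [IsProbabilityMeasure P₂]

/-- Convergence of types for scaling actions: if `W i → Y` and `T (a i) ∘ W i → Y'` in
distribution, with nonzero limits, then `a i` converges in `(0, ∞)`. -/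
theorem exists_tendsto_scale {ι : Type*} {u : Filter ι} [u.IsCountablyGenerated] [u.NeBot]
    (hT : IsScalingAction T) {W Z : ι → Ω → PathSpace τ V}
    (hY : Measurable Y) (hY' : Measurable Y')
    (hY0 : ¬ ∀ᵐ ω ∂P₁, ∀ l, Y ω l = 0) (hY'0 : ¬ ∀ᵐ ω ∂P₂, ∀ l, Y' ω l = 0)
    (hW : TendstoInDistribution W u Y (fun _ => P) P₁)
    (hZ : TendstoInDistribution Z u Y' (fun _ => P) P₂) {a : ι → ℝ} (ha : ∀ᶠ i in u, 0 < a i)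
    (hWZ : ∀ᶠ i in u, ∀ᵐ ω ∂P, ∀ l, Z i ω l = T (a i) (W i ω l)) :
    ∃ b : ℝ, 0 < b ∧ Tendsto a u (𝓝 b) ∧
      EqInDistribution τ P₂ P₁ (fun ω l => Y' ω l) (fun ω l => T b (Y ω l)) := by
  have hsub : ∀ ns : ℕ → ι, Tendsto ns atTop u → ∃ ms : ℕ → ℕ, ∃ b : ℝ, 0 < b ∧
      Tendsto (fun n => a (ns (ms n))) atTop (𝓝 b) ∧
      EqInDistribution τ P₂ P₁ (fun ω l => Y' ω l) (fun ω l => T b (Y ω l)) := by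
    intro ns hns
    obtain ⟨L, ms, hms, hL⟩ := CompactSpace.tendsto_subseq fun n => ENNReal.ofReal (a (ns n))
    have hns' : Tendsto (fun n => ns (ms n)) atTop u := hns.comp hms.tendsto_atTop
    have hW' := tendstoInDistribution_comp_tendsto hW hns'
    have hZ' := tendstoInDistribution_comp_tendsto hZ hns'
    have ha' := hns'.eventually ha
    have hWZ' := hns'.eventually hWZ
    have hfin : L ≠ ⊤ → Tendsto (fun n => a (ns (ms n))) atTop (𝓝 L.toReal) := fun h =>
      ((ENNReal.tendsto_toReal h).comp hL).congr'
        (ha'.mono fun n hn => ENNReal.toReal_ofReal hn.le)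
    rcases eq_or_ne L 0 with h0 | h0
    · have hlim := hfin (h0 ▸ ENNReal.zero_ne_top)
      rw [h0, ENNReal.toReal_zero] at hlim
      have h := eqInDistribution_of_tendsto (ψ := fun _ => (0 : V)) continuous_const
        (hT.tendsto_of_zero ha' hlim) hY hY' hW' hZ' hWZ'
      exact absurd (ae_eq_zero_of_eqInDistribution h (Eventually.of_forall fun _ _ => rfl))
        hY'0
    rcases eq_or_ne L ⊤ with h1 | h1
    · -- In this case the roles of the two sequences are exchanged.
      have hlim : Tendsto (fun n => (a (ns (ms n)))⁻¹) atTop (𝓝 0) := by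
        rw [h1] at hL
        exact tendsto_inv_atTop_zero.comp (ENNReal.tendsto_ofReal_nhds_top.1 hL)
      have h := eqInDistribution_of_tendsto (ψ := fun _ => (0 : V)) continuous_const
        (hT.tendsto_of_zero (ha'.mono fun n hn => inv_pos.2 hn) hlim) hY' hY hZ' hW'
        ((ha'.and hWZ').mono fun n hn => hn.2.mono fun ω hω l => hT.inv_apply hn.1 (hω l))
      exact absurd (ae_eq_zero_of_eqInDistribution h (Eventually.of_forall fun _ _ => rfl)) hY0
    · have hb : 0 < L.toReal := ENNReal.toReal_pos h0 h1
      exact ⟨ms, L.toReal, hb, hfin h1, eqInDistribution_of_tendsto (hT.continuous_apply hb)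
        (hT.tendsto_of_pos ha' hb (hfin h1)) hY hY' hW' hZ' hWZ'⟩
  obtain ⟨ns, hns⟩ := u.exists_seq_tendsto
  obtain ⟨-, b, hb, -, hbY⟩ := hsub ns hns
  refine ⟨b, hb, tendsto_of_subseq_tendsto fun ns hns => ?_, hbY⟩
  obtain ⟨ms, b', hb', hlim, hbY'⟩ := hsub ns hns
  rw [scale_unique hT hY hY' hY'0 hb hb' hbY hbY']
  exact ⟨ms, hlim⟩

end Types

/-! ### The scaling exponent -/

/-- Cauchy's functional equation in multiplicative form. -/
theorem exists_eq_rpow {A : ℝ → ℝ} (hpos : ∀ h, 0 < A h)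
    (hmul : ∀ g h, 0 < g → 0 < h → A (g * h) = A g * A h) (hA1 : Tendsto A (𝓝 1) (𝓝 1)) :
    ∃ α : ℝ, ∀ h, 0 < h → A h = h ^ α := by
  let L : ℝ →+ ℝ := AddMonoidHom.mk' (fun x => Real.log (A (Real.exp x))) fun x y => by
    rw [Real.exp_add, hmul _ _ (Real.exp_pos x) (Real.exp_pos y),
      Real.log_mul (hpos _).ne' (hpos _).ne']
  have hL : ∀ x, L x = Real.log (A (Real.exp x)) := fun _ => rfl
  have hcont : Continuous L := by
    refine continuous_of_continuousAt_zero L ?_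
    rw [ContinuousAt, map_zero]
    have h1 : Tendsto Real.exp (𝓝 0) (𝓝 1) := Real.exp_zero ▸ Real.continuous_exp.tendsto 0
    have h2 : Tendsto Real.log (𝓝 1) (𝓝 0) :=
      Real.log_one ▸ (Real.continuousAt_log one_ne_zero).tendsto
    exact h2.comp (hA1.comp h1)
  refine ⟨L 1, fun h hh => ?_⟩
  have h1 : L (Real.log h) = Real.log h * L 1 := by
    have := map_real_smul L hcont (Real.log h) 1
    simpa using this
  rw [hL, Real.exp_log hh] at h1
  rw [Real.rpow_def_of_pos hh, ← h1, Real.exp_log (hpos h)]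

section Dilation

variable {d k : ℕ} {τ : Nodes d k} {V : Type*} [NormedAddCommGroup V] [Module ℂ V]
  [ContinuousSMul ℂ V] {Ω₁ : Type*} [MeasurableSpace Ω₁] {P₁ : Measure Ω₁}
  {Y : Ω₁ → PathSpace τ V} {T : ℝ → V → V}

theorem PathSpace.measurable_dilate (r : ℝ) : Measurable (PathSpace.dilate (τ := τ) (V := V) r) :=
  (PathSpace.continuous_dilate.comp (continuous_const.prodMk continuous_id)).measurable

theorem PathSpace.dilate_inv_dilate {h : ℝ} (hh : h ≠ 0) (f : PathSpace τ V) :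
    (f.dilate h).dilate h⁻¹ = f :=
  PathSpace.eq_of_forall fun l => by
    rw [PathSpace.dilate_apply, PathSpace.dilate_apply, rescale_rescale_zero, inv_mul_cancel₀ hh,
      rescale_zero_one]

theorem not_ae_dilate_eq_zero {h : ℝ} (hh : h ≠ 0) (h0 : ¬ ∀ᵐ ω ∂P₁, ∀ l, Y ω l = 0) :
    ¬ ∀ᵐ ω ∂P₁, ∀ l, (Y ω).dilate h l = 0 := by
  refine fun H => h0 (H.mono fun ω hω l => ?_)
  rw [← PathSpace.dilate_inv_dilate hh (Y ω), PathSpace.dilate_apply, hω]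

theorem tendstoInDistribution_dilate [IsProbabilityMeasure P₁] (hY : Measurable Y) {u : Filter ℝ}
    [u.IsCountablyGenerated] {h₀ : ℝ} (hu : u ≤ 𝓝 h₀) :
    TendstoInDistribution (fun h ω => (Y ω).dilate h) u (fun ω => (Y ω).dilate h₀)
      (fun _ => P₁) P₁ := by
  refine tendstoInDistribution_of_ae_tendsto
    (fun h => ((PathSpace.measurable_dilate h).comp hY).aemeasurable)
    ((PathSpace.measurable_dilate h₀).comp hY).aemeasurable (Eventually.of_forall fun ω => ?_)
  exact ((PathSpace.continuous_dilate.comp (continuous_id.prodMk continuous_const)).tendsto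
    h₀).mono_left hu

variable [IsProbabilityMeasure P₁]

/-- If each dilation of `Y` is a rescaling of `Y` by `A h`, in distribution, then `A` is continuous
at `1`, since `Y (h · l)` depends continuously on `h`. -/
theorem tendsto_scale_one (hT : IsScalingAction T) (hY : Measurable Y)
    (hY0 : ¬ ∀ᵐ ω ∂P₁, ∀ l, Y ω l = 0) {A : ℝ → ℝ} (hA : ∀ h, 0 < A h)
    (h : ∀ h, 0 < h → EqInDistribution τ P₁ P₁ (fun ω l => (Y ω).dilate h l)
      (fun ω l => T (A h) (Y ω l))) :
    Tendsto A (𝓝 1) (𝓝 1) := by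
  have hu : ∀ᶠ h in 𝓝 (1 : ℝ), 0 < h := eventually_gt_nhds one_pos
  have hspec : ∀ h : ℝ, 0 < h → _ := fun g hg =>
    (eqInDistribution_iff (hT.continuous_apply (hA g)) hY
    ((PathSpace.measurable_dilate g).comp hY)).1 (h g hg)
  have hlim := tendstoInDistribution_dilate (P₁ := P₁) hY (le_refl (𝓝 (1 : ℝ)))
  simp only [PathSpace.dilate_one] at hlim
  have hlim' : TendstoInDistribution (fun h ω => (Y ω).transform (T (A h))) (𝓝 1) Y
      (fun _ => P₁) P₁ :=
    tendstoInDistribution_congr_map hlim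
      (fun g => ((PathSpace.measurable_transform (hT.continuous_apply (hA g))).comp hY).aemeasurable)
      (hu.mono fun g hg => (hspec g hg).2)
  obtain ⟨b, hb, hAb, hYb⟩ := exists_tendsto_scale hT hY hY hY0 hY0
    (tendstoInDistribution_const hY.aemeasurable) hlim' (Eventually.of_forall hA)
    (hu.mono fun g hg => (hspec g hg).1)
  have h1 : EqInDistribution τ P₁ P₁ (fun ω l => Y ω l) (fun ω l => T 1 (Y ω l)) := by
    simp only [hT.one]
    exact ⟨Y, Y, ⟨hY, Eventually.of_forall fun _ _ => rfl⟩,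
      ⟨hY, Eventually.of_forall fun _ _ => rfl⟩, rfl⟩
  rwa [scale_unique hT hY hY hY0 hb one_pos hYb h1] at hAb

/-- The exponent of self-similarity is positive: `Y (h · l) → 0` as `h ↓ 0`, while
`T (h ^ α) ∘ Y` dominates `Y` for `h ≤ 1` if `α ≤ 0`. -/
theorem exponent_pos (hT : IsScalingAction T) (hY : Measurable Y)
    (hY0 : ¬ ∀ᵐ ω ∂P₁, ∀ l, Y ω l = 0) {α : ℝ}
    (h : ∀ h : ℝ, 0 < h → EqInDistribution τ P₁ P₁ (fun ω l => (Y ω).dilate h l)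
      (fun ω l => T (h ^ α) (Y ω l))) : 0 < α := by
  by_contra hα
  have hu : ∀ᶠ h in 𝓝[>] (0 : ℝ), 0 < h := self_mem_nhdsWithin
  -- Outside of `(0, ∞)` the parameter is irrelevant, and it is set to `1`.
  let A : ℝ → ℝ := fun h => if 0 < h then h ^ α else 1
  have hA : ∀ h, 0 < A h := fun g => by
    by_cases hg : 0 < g
    · simp only [A, hg, if_true]; positivity
    · simp only [A, hg, if_false]; exact one_pos
  have hAeq : ∀ h, 0 < h → A h = h ^ α := fun g hg => if_pos hg
  have hspec : ∀ h : ℝ, 0 < h → _ := fun g hg =>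
    (eqInDistribution_iff (hT.continuous_apply (hA g)) hY
    ((PathSpace.measurable_dilate g).comp hY)).1 (hAeq g hg ▸ h g hg)
  have hlim := tendstoInDistribution_dilate (P₁ := P₁) hY
    (nhdsWithin_le_nhds (a := (0 : ℝ)) (s := Set.Ioi 0))
  simp only [PathSpace.dilate_zero] at hlim
  have hlim' : TendstoInDistribution (fun h ω => (Y ω).transform (T (A h))) (𝓝[>] 0)
      (fun _ => (0 : PathSpace τ V)) (fun _ => P₁) P₁ :=
    tendstoInDistribution_congr_map hlim
      (fun g => ((PathSpace.measurable_transform (hT.continuous_apply (hA g))).comp hY).aemeasurable)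
      (hu.mono fun g hg => (hspec g hg).2)
  have hrel : ∀ᶠ g in 𝓝[>] (0 : ℝ), ∀ᵐ ω ∂P₁, ∀ l,
      Y ω l = T (A g)⁻¹ ((Y ω).transform (T (A g)) l) :=
    hu.mono fun g hg => (hspec g hg).1.mono fun ω hω l => hT.inv_apply (hA g) (hω l)
  have hinv : ∀ᶠ g in 𝓝[>] (0 : ℝ), 0 < (A g)⁻¹ := Eventually.of_forall fun g => inv_pos.2 (hA g)
  have hconst : TendstoInDistribution (fun _ : ℝ => Y) (𝓝[>] 0) Y (fun _ => P₁) P₁ :=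
    tendstoInDistribution_const hY.aemeasurable
  have hAinv : ∀ᶠ g in 𝓝[>] (0 : ℝ), g ^ (-α) = (A g)⁻¹ := hu.mono fun g hg => by
    rw [hAeq g hg, Real.rpow_neg (le_of_lt hg)]
  rcases (not_lt.1 hα).lt_or_eq with hneg | hzero
  · have h1 : Tendsto (fun g => (A g)⁻¹) (𝓝[>] 0) (𝓝 0) := by
      have h2 : Tendsto (fun g : ℝ => g ^ (-α)) (𝓝[>] 0) (𝓝 0) := by
        have h3 := (Real.continuousAt_rpow_const 0 (-α) (Or.inr (by linarith))).tendsto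
        rw [Real.zero_rpow (by linarith)] at h3
        exact h3.mono_left nhdsWithin_le_nhds
      exact h2.congr' hAinv
    exact hY0 (ae_eq_zero_of_eqInDistribution
      (eqInDistribution_of_tendsto (ψ := fun _ => (0 : V)) continuous_const
        (hT.tendsto_of_zero hinv h1) measurable_const hY hlim' hconst hrel)
      (Eventually.of_forall fun _ _ => rfl))
  · have h1 : Tendsto (fun g => (A g)⁻¹) (𝓝[>] 0) (𝓝 1) :=
      tendsto_const_nhds.congr' (hAinv.mono fun g hg => by
        simp only [← hg, hzero, neg_zero, Real.rpow_zero])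
    exact hY0 (ae_eq_zero_of_eqInDistribution
      (eqInDistribution_of_tendsto (hT.continuous_apply one_pos)
        (hT.tendsto_of_pos hinv one_pos h1) measurable_const hY hlim' hconst hrel)
      (Eventually.of_forall fun _ l => by rw [PathSpace.zero_apply, hT.zero 1 one_pos]))

end Dilation

/-! ### Tangent fields -/

section Tangent

variable {d k : ℕ} {τ : Nodes d k} {V : Type*} [NormedAddCommGroup V] [Module ℂ V]
  [ContinuousSMul ℂ V] {Ω Ω₁ Ω₂ : Type*} [MeasurableSpace Ω] [MeasurableSpace Ω₁]
  [MeasurableSpace Ω₂] {P : Measure Ω} {P₁ : Measure Ω₁} {P₂ : Measure Ω₂}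
  [IsProbabilityMeasure P] [IsProbabilityMeasure P₁] [IsProbabilityMeasure P₂]
  {X : Ω → PathSpace τ V} {Y : Ω₁ → PathSpace τ V} {Y' : Ω₂ → PathSpace τ V}
  {T : ℝ → V → V} {s : Point d} {c c' : ℝ → ℝ}

theorem IsTangentField.exists_tendsto_div (hT : IsScalingAction T)
    (hY : IsTangentField P P₁ T X s c Y) (hY' : IsTangentField P P₂ T X s c' Y') :
    ∃ a : ℝ, 0 < a ∧ Tendsto (fun r => c' r / c r) (𝓝[>] 0) (𝓝 a) ∧
      EqInDistribution τ P₂ P₁ (fun ω l => Y' ω l) (fun ω l => T a (Y ω l)) := by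
  obtain ⟨Z, hZ, hZlim⟩ := hY.converges
  obtain ⟨Z', hZ', hZlim'⟩ := hY'.converges
  have hu : ∀ᶠ r in 𝓝[>] (0 : ℝ), 0 < r := self_mem_nhdsWithin
  refine exists_tendsto_scale hT hY.measurable hY'.measurable hY.nonzero hY'.nonzero hZlim hZlim'
    (hu.mono fun r hr => div_pos (hY'.pos r hr) (hY.pos r hr)) (hu.mono fun r hr => ?_)
  filter_upwards [(hZ r hr).ae_eq, (hZ' r hr).ae_eq] with ω h h' l
  rw [h, h', hT.comp _ _ (div_pos (hY'.pos r hr) (hY.pos r hr)) (hY.pos r hr),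
    div_mul_cancel₀ _ (hY.pos r hr).ne']

theorem tendsto_mul_nhdsGT_zero {h : ℝ} (hh : 0 < h) :
    Tendsto (fun r => h * r) (𝓝[>] 0) (𝓝[>] 0) := by
  refine tendsto_nhdsWithin_iff.2
    ⟨?_, eventually_mem_nhdsWithin.mono fun r (hr : 0 < r) => mul_pos hh hr⟩
  simpa using ((continuous_const_mul h).tendsto 0).mono_left nhdsWithin_le_nhds

/-- The process `T (c r) (X (s + r h · l))` converges to `Y (h · l)`, and it is the rescaling by
`c r / c (h r)` of a process that converges to `Y`. -/
theorem IsTangentField.exists_tendsto_div_mul (hT : IsScalingAction T)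
    (hY : IsTangentField P P₁ T X s c Y) {h : ℝ} (hh : 0 < h) :
    ∃ a : ℝ, 0 < a ∧ Tendsto (fun r => c r / c (h * r)) (𝓝[>] 0) (𝓝 a) ∧
      EqInDistribution τ P₁ P₁ (fun ω l => (Y ω).dilate h l) (fun ω l => T a (Y ω l)) := by
  obtain ⟨Z, hZ, hZlim⟩ := hY.converges
  have hu : ∀ᶠ r in 𝓝[>] (0 : ℝ), 0 < r := self_mem_nhdsWithin
  have hdil : Continuous (PathSpace.dilate (τ := τ) (V := V) h) :=
    PathSpace.continuous_dilate.comp (continuous_const.prodMk continuous_id)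
  refine exists_tendsto_scale hT hY.measurable (hdil.measurable.comp hY.measurable) hY.nonzero
    (not_ae_dilate_eq_zero hh.ne' hY.nonzero)
    (tendstoInDistribution_comp_tendsto hZlim (tendsto_mul_nhdsGT_zero hh)) (hZlim.continuous_comp hdil)
    (hu.mono fun r hr => div_pos (hY.pos r hr) (hY.pos _ (mul_pos hh hr)))
    (hu.mono fun r hr => ?_)
  have hhr := mul_pos hh hr
  filter_upwards [(hZ r hr).ae_eq, (hZ (h * r) hhr).ae_eq] with ω h1 h2 l
  rw [Function.comp_apply, PathSpace.dilate_apply, h1, h2, rescale_rescale_zero,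
    hT.comp _ _ (div_pos (hY.pos r hr) (hY.pos _ hhr)) (hY.pos _ hhr),
    div_mul_cancel₀ _ (hY.pos _ hhr).ne']

theorem IsTangentField.exists_exponent (hT : IsScalingAction T)
    (hY : IsTangentField P P₁ T X s c Y) :
    ∃ α : ℝ, 0 < α ∧ (∀ h : ℝ, 0 < h →
      EqInDistribution τ P₁ P₁ (fun ω l => (Y ω).dilate h l) (fun ω l => T (h ^ α) (Y ω l))) ∧
      ∀ h : ℝ, 0 < h → Tendsto (fun r => c r / c (h * r)) (𝓝[>] 0) (𝓝 (h ^ α)) := by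
  have hu : ∀ᶠ r in 𝓝[>] (0 : ℝ), 0 < r := self_mem_nhdsWithin
  -- The scale is chosen positive for all real `h`, so that each `T (A h)` is continuous.
  have hex : ∀ h : ℝ, ∃ a : ℝ, 0 < a ∧ (0 < h →
      Tendsto (fun r => c r / c (h * r)) (𝓝[>] 0) (𝓝 a) ∧
      EqInDistribution τ P₁ P₁ (fun ω l => (Y ω).dilate h l) (fun ω l => T a (Y ω l))) := by
    intro h
    by_cases hh : 0 < h
    · obtain ⟨a, ha, h1⟩ := hY.exists_tendsto_div_mul hT hh
      exact ⟨a, ha, fun _ => h1⟩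
    · exact ⟨1, one_pos, fun h1 => absurd h1 hh⟩
  choose A hA hAspec using hex
  have hmulA : ∀ g h, 0 < g → 0 < h → A (g * h) = A g * A h := by
    intro g h hg hh
    have hmul := tendsto_mul_nhdsGT_zero hh
    refine tendsto_nhds_unique (hAspec _ (mul_pos hg hh)).1
      ((((hAspec g hg).1.comp hmul).mul (hAspec h hh).1).congr' (hu.mono fun r hr => ?_))
    have h1 := (hY.pos _ (mul_pos hh hr)).ne'
    simp only [Function.comp_apply]
    rw [mul_comm, div_mul_div_cancel₀ h1, mul_assoc]
  obtain ⟨α, hα⟩ := exists_eq_rpow hA hmulA (tendsto_scale_one hT hY.measurable hY.nonzero hA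
    fun h hh => (hAspec h hh).2)
  have hdist : ∀ h : ℝ, 0 < h → EqInDistribution τ P₁ P₁ (fun ω l => (Y ω).dilate h l)
      (fun ω l => T (h ^ α) (Y ω l)) := fun h hh => hα h hh ▸ (hAspec h hh).2
  exact ⟨α, exponent_pos hT hY.measurable hY.nonzero hdist, hdist,
    fun h hh => hα h hh ▸ (hAspec h hh).1⟩

/-- If `c r / c (h r) → h ^ α` for every `h`, then `r ^ α * c r` is slowly varying. -/
theorem slowlyVaryingAtZero_rpow_mul {α : ℝ} (hpos : ∀ r, 0 < r → 0 < c r)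
    (hc : ∀ h : ℝ, 0 < h → Tendsto (fun r => c r / c (h * r)) (𝓝[>] 0) (𝓝 (h ^ α))) :
    SlowlyVaryingAtZero fun r => r ^ α * c r := by
  refine ⟨fun r hr => mul_pos (Real.rpow_pos_of_pos hr α) (hpos r hr), fun h hh => ?_⟩
  have hp : (0 : ℝ) < h ^ α := Real.rpow_pos_of_pos hh α
  have h1 := ((hc h hh).inv₀ hp.ne').const_mul (h ^ α)
  rw [mul_inv_cancel₀ hp.ne'] at h1
  refine h1.congr' (eventually_mem_nhdsWithin.mono fun r (hr : 0 < r) => ?_)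
  have h2 : (0 : ℝ) < r ^ α := Real.rpow_pos_of_pos hr α
  have h3 := hpos r hr
  simp only [Real.mul_rpow hh.le hr.le]
  field_simp

end Tangent

end TangentField

end

/-- `V` is a complete separable metric linear space over `ℂ` with a translation invariant metric:
`NormedAddCommGroup V` says that `dist x y = ‖x - y‖` with `‖x‖ = dist x 0`, and homogeneity of
`‖·‖` (a `NormedSpace`) is not assumed, only continuity of the scalar multiplication. -/
theorem theorem3p1 {d k : ℕ} (τ : TangentField.Nodes d k)
    {V : Type*} [NormedAddCommGroup V] [Module ℂ V] [ContinuousSMul ℂ V] [CompleteSpace V]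
    [TopologicalSpace.SeparableSpace V]
    (T : ℝ → V → V) (hT : TangentField.IsScalingAction T)
    {Ω Ω₁ : Type*} [MeasurableSpace Ω] [MeasurableSpace Ω₁]
    (P : Measure Ω) [IsProbabilityMeasure P] (P₁ : Measure Ω₁) [IsProbabilityMeasure P₁]
    (X : Ω → TangentField.PathSpace τ V) (hX : Measurable X) (s : TangentField.Point d)
    (c : ℝ → ℝ) (Y : Ω₁ → TangentField.PathSpace τ V)
    (hY : TangentField.IsTangentField P P₁ T X s c Y) :
    (∃ α : ℝ, 0 < α ∧
      (∀ r : ℝ, 0 < r → TangentField.EqInDistribution τ P₁ P₁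
        (fun ω l => Y ω (TangentField.rescale 0 r l)) (fun ω l => T (r ^ α) (Y ω l))) ∧
      ∃ ℓ : ℝ → ℝ, TangentField.SlowlyVaryingAtZero ℓ ∧ ∀ r : ℝ, 0 < r → c r = r ^ (-α) * ℓ r) ∧
    (∀ {Ω₂ : Type*} [MeasurableSpace Ω₂] (P₂ : Measure Ω₂) [IsProbabilityMeasure P₂]
      (c' : ℝ → ℝ) (Y' : Ω₂ → TangentField.PathSpace τ V),
      TangentField.IsTangentField P P₂ T X s c' Y' →
      ∃ a : ℝ, 0 < a ∧ Tendsto (fun r => c' r / c r) (𝓝[>] 0) (𝓝 a) ∧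
        TangentField.EqInDistribution τ P₂ P₁ (fun ω l => Y' ω l) (fun ω l => T a (Y ω l))) := by
  obtain ⟨α, hα, hdist, hlim⟩ := hY.exists_exponent hT
  refine ⟨⟨α, hα, hdist, fun r => r ^ α * c r,
    TangentField.slowlyVaryingAtZero_rpow_mul hY.pos hlim, fun r hr => ?_⟩,
    fun P₂ _ c' Y' hY' => hY.exists_tendsto_div hT hY'⟩
  rw [← mul_assoc, ← Real.rpow_add hr, neg_add_cancel, Real.rpow_zero, one_mul]
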